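/- Let $n\ge 0$ be an integer and $\gamma>0$ real. Let $\mathbb{B}_n$ be the open unit ball of $\mathbb{C}^n$ and let $H_\gamma$ be the Hilbert space of functions on $\mathbb{B}_n$ with reproducing kernel $K^\gamma(w,z)=(1-\langle w,z\rangle)^{-\gamma}$. For $a\in\mathbb{B}_n$ put $k^\gamma_a(w)=(1-|a|^2)^{\gamma/2}/(1-\langle w,a\rangle)^{\gamma}$. For an analytic function $f:\mathbb{B}_n\to\mathbb{C}$ and an analytic map $\varphi:\mathbb{B}_n\to\mathbb{B}_n$, let $W_{f,\varphi}$ be the operator $W_{f,\varphi}h=f\cdot(h\circ\varphi)$ whose domain consists of all $h\in H_\gamma$ with $f\cdot(h\circ\varphi)\in H_\gamma$. Let $f,g$ be analytic functions on $\mathbb{B}_n$ and let $\varphi,\psi$ be analytic self-maps of $\mathbb{B}_n$. No boundedness is assumed: "$W_{f,\varphi}W_{g,\psi}^*=I$ on $H_\gamma$" means that $W_{g,\psi}$ is densely defined (so that its adjoint exists) and that for each $h\in H_\gamma$ the vector $W_{f,\varphi}(W_{g,\psi}^*h)$ is defined and equals $h$; for bounded $W_{f,\varphi}$ and $W_{g,\psi}$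 this is the usual operator identity. Then $W_{f,\varphi}W_{g,\psi}^*=I$ on $H_\gamma$ if and only if $\varphi=\psi$ is an automorphism of $\mathbb{B}_n$ (a bijective analytic self-map with analytic inverse) and there is a constant $\lambda\in\mathbb{C}\setminus\{0\}$ such that $f=\lambda k^\gamma_a$ and $g=(1/\overline{\lambda})k^\gamma_a$, where $a=\varphi^{-1}(0)$. Furthermore, in this case $W_{k^\gamma_a,\varphi}$ is a (bounded, everywhere defined) unitary operator on $H_\gamma$, and both $W_{f,\varphi}$ and $W_{g,\psi}$ are constant multiples of it. -/

import Mathlib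

open scoped ComplexConjugate InnerProductSpace LinearPMap

/-- The open unit ball of `ℂⁿ` (Euclidean norm), as a type. -/
abbrev UnitBall (n : ℕ) : Type := Metric.ball (0 : EuclideanSpace ℂ (Fin n)) 1

/-- The centre of the unit ball. -/
def UnitBall.center (n : ℕ) : UnitBall n := ⟨0, by simp⟩

/-- Analyticity of a map defined on the unit ball: it is the restriction of a map on `ℂⁿ` that is
complex analytic at each point of the ball (the values outside the ball play no role). -/
def AnalyticOnBall {n : ℕ} {E : Type*} [NormedAddCommGroup E] [NormedSpace ℂ E]
    (f : UnitBall n → E) : Prop :=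
  ∃ F : EuclideanSpace ℂ (Fin n) → E,
    AnalyticOnNhd ℂ F (Metric.ball 0 1) ∧ ∀ z : UnitBall n, F z = f z

/-- Analyticity of a self-map of the unit ball. -/
def AnalyticSelfMap {n : ℕ} (φ : UnitBall n → UnitBall n) : Prop :=
  AnalyticOnBall fun z => (φ z : EuclideanSpace ℂ (Fin n))

/-- Automorphisms of the unit ball: analytic self-maps with an analytic two-sided inverse. -/
def IsBallAutomorphism {n : ℕ} (φ : UnitBall n → UnitBall n) : Prop :=
  AnalyticSelfMap φ ∧ ∃ χ : UnitBall n → UnitBall n,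
    AnalyticSelfMap χ ∧ Function.LeftInverse χ φ ∧ Function.RightInverse χ φ

/-- `K^γ(w, z) = (1 - ⟨w, z⟩)^(-γ)`, where `⟨w, z⟩ = ∑ wⱼ conj zⱼ`, which is `inner ℂ z w` in
Mathlib's convention. The power is the principal one; `1 - ⟨w, z⟩` has positive real part. -/
noncomputable def ballKernel {n : ℕ} (γ : ℝ) (w z : UnitBall n) : ℂ :=
  1 / (1 - inner ℂ (z : EuclideanSpace ℂ (Fin n)) (w : EuclideanSpace ℂ (Fin n))) ^ (γ : ℂ)

/-- The kernel `K^γ`, its values being regarded as multiplication operators on `ℂ`. -/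
noncomputable def ballKernelMatrix (n : ℕ) (γ : ℝ) :
    Matrix (UnitBall n) (UnitBall n) (ℂ →L[ℂ] ℂ) :=
  Matrix.of fun w z => ballKernel γ w z • ContinuousLinearMap.id ℂ ℂ

theorem UnitBall.norm_inner_lt_one {n : ℕ} (z w : UnitBall n) :
    ‖inner ℂ (z : EuclideanSpace ℂ (Fin n)) (w : EuclideanSpace ℂ (Fin n))‖ < 1 := by
  have hz : ‖(z : EuclideanSpace ℂ (Fin n))‖ < 1 := mem_ball_zero_iff.mp z.2
  have hw : ‖(w : EuclideanSpace ℂ (Fin n))‖ < 1 := mem_ball_zero_iff.mp w.2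
  refine (norm_inner_le_norm _ _).trans_lt ?_
  nlinarith [norm_nonneg (z : EuclideanSpace ℂ (Fin n)),
    norm_nonneg (w : EuclideanSpace ℂ (Fin n))]

theorem UnitBall.one_sub_inner_mem_slitPlane {n : ℕ} (z w : UnitBall n) :
    1 - inner ℂ (z : EuclideanSpace ℂ (Fin n)) (w : EuclideanSpace ℂ (Fin n)) ∈
      Complex.slitPlane := by
  rw [sub_eq_add_neg]
  apply Complex.mem_slitPlane_of_norm_lt_one
  simpa using UnitBall.norm_inner_lt_one z w

theorem ballKernel_conj {n : ℕ} (γ : ℝ) (w z : UnitBall n) :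
    conj (ballKernel γ w z) = ballKernel γ z w := by
  have h := Complex.slitPlane_arg_ne_pi (UnitBall.one_sub_inner_mem_slitPlane w z)
  have h' := Complex.cpow_conj (1 - inner ℂ (w : EuclideanSpace ℂ (Fin n)) z.1) (γ : ℂ) h
  simp only [map_sub, map_one, inner_conj_symm, Complex.conj_ofReal] at h'
  simp only [ballKernel, map_div₀, map_one, h']

theorem ballKernel_coeff_nonneg {γ : ℝ} (hγ : 0 < γ) (k : ℕ) :
    0 ≤ Ring.choose (γ + k - 1) k := by
  have h : (k.factorial : ℝ) * Ring.choose (γ + k - 1) k = (ascPochhammer ℝ k).eval γ := by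
    rw [← nsmul_eq_mul, ← Ring.descPochhammer_eq_factorial_smul_choose,
      Polynomial.descPochhammer_smeval_eq_ascPochhammer,
      Polynomial.ascPochhammer_smeval_cast, Polynomial.ascPochhammer_smeval_eq_eval]
    congr 1; ring
  have hp := ascPochhammer_pos k γ hγ
  have hk : (0 : ℝ) < k.factorial := by positivity
  nlinarith [pos_of_mul_pos_right (h ▸ hp) hk.le]

theorem ballKernel_hasSum {n : ℕ} (γ : ℝ) (w z : UnitBall n) :
    HasSum (fun k : ℕ => ((Ring.choose (γ + k - 1) k : ℝ) : ℂ) *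
      (inner ℂ (z : EuclideanSpace ℂ (Fin n)) (w : EuclideanSpace ℂ (Fin n))) ^ k)
      (ballKernel γ w z) := by
  have h := (Complex.one_div_one_sub_cpow_hasFPowerSeriesOnBall_zero (γ : ℂ)).hasSum
    (y := inner ℂ (z : EuclideanSpace ℂ (Fin n)) (w : EuclideanSpace ℂ (Fin n))) (by
      have := UnitBall.norm_inner_lt_one z w
      rw [← ENNReal.ofReal_one, Metric.eball_ofReal]
      simpa using this)
  rw [zero_add] at h
  unfold ballKernel
  refine h.congr_fun ?_
  intro k
  rw [FormalMultilinearSeries.ofScalars_apply_eq, Complex.ofReal_choose, smul_eq_mul]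
  push_cast
  rfl

theorem re_sum_inner_pow_nonneg {n : ℕ} (c : UnitBall n →₀ ℂ) (k : ℕ) :
    0 ≤ (∑ x ∈ c.support, ∑ y ∈ c.support, c x * conj (c y) *
      (inner ℂ (x : EuclideanSpace ℂ (Fin n)) (y : EuclideanSpace ℂ (Fin n))) ^ k).re := by
  have hpow (x y : UnitBall n) :
      (inner ℂ (x : EuclideanSpace ℂ (Fin n)) (y : EuclideanSpace ℂ (Fin n))) ^ k =
        ∑ p : Fin k → Fin n, (∏ i, conj (x.1 (p i))) * ∏ i, y.1 (p i) := by
    rw [PiLp.inner_apply, Finset.sum_pow']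
    simp [Finset.prod_mul_distrib, mul_comm]
  have h : (∑ x ∈ c.support, ∑ y ∈ c.support, c x * conj (c y) *
      (inner ℂ (x : EuclideanSpace ℂ (Fin n)) (y : EuclideanSpace ℂ (Fin n))) ^ k) =
      ∑ p : Fin k → Fin n, (∑ x ∈ c.support, c x * ∏ i, conj (x.1 (p i))) *
        conj (∑ x ∈ c.support, c x * ∏ i, conj (x.1 (p i))) := by
    simp only [hpow, Finset.mul_sum, map_sum, Finset.sum_mul]
    rw [Finset.sum_congr rfl fun x _ => Finset.sum_comm, Finset.sum_comm]
    refine Finset.sum_congr rfl fun p _ => ?_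
    rw [Finset.sum_comm]
    refine Finset.sum_congr rfl fun x _ => Finset.sum_congr rfl fun y _ => ?_
    simp only [map_mul, map_prod, Complex.conj_conj]
    ring
  rw [h, Complex.re_sum]
  refine Finset.sum_nonneg fun p _ => ?_
  rw [Complex.mul_conj]
  simpa using Complex.normSq_nonneg _

theorem ballKernelMatrix_posSemidef (n : ℕ) {γ : ℝ} (hγ : 0 < γ) :
    (ballKernelMatrix n γ).PosSemidef := by
  refine ((RKHS.posSemidef_tfae (K := ballKernelMatrix n γ)).out 0 2 :
    _ ↔ (ballKernelMatrix n γ).IsHermitian ∧ _).mpr ⟨?_, fun c => ?_⟩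
  · ext x y
    simp [ballKernelMatrix, ContinuousLinearMap.star_eq_adjoint, ballKernel_conj,
      ContinuousLinearMap.adjoint_id]
  · have hs : HasSum (fun k : ℕ => ∑ x ∈ c.support, ∑ y ∈ c.support, conj (c x) * c y *
        (((Ring.choose (γ + k - 1) k : ℝ) : ℂ) *
      (inner ℂ (y : EuclideanSpace ℂ (Fin n)) (x : EuclideanSpace ℂ (Fin n))) ^ k))
        (∑ x ∈ c.support, ∑ y ∈ c.support, conj (c x) * c y * ballKernel γ x y) :=
      hasSum_sum fun x _ => hasSum_sum fun y _ => (ballKernel_hasSum γ x y).mul_left _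
    have hre := (Complex.reCLM.hasSum hs).nonneg fun k => ?_
    · refine hre.trans_eq (Eq.symm ?_)
      simp only [Finsupp.sum, RCLike.re_to_complex, Complex.reCLM_apply]
      congr 1
      refine Finset.sum_congr rfl fun x _ => Finset.sum_congr rfl fun y _ => ?_
      simp only [ballKernelMatrix, Matrix.of_apply, smul_apply, ContinuousLinearMap.id_apply,
        smul_eq_mul, RCLike.inner_apply, map_mul, ballKernel_conj]
      ring
    · have h := mul_nonneg (ballKernel_coeff_nonneg hγ k) (re_sum_inner_pow_nonneg c k)
      rw [← Complex.re_ofReal_mul] at h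
      refine h.trans_eq ?_
      rw [Complex.reCLM_apply, Finset.sum_comm]
      simp only [Finset.mul_sum]
      congr 1
      refine Finset.sum_congr rfl fun x _ => Finset.sum_congr rfl fun y _ => ?_
      ring

instance ballKernelMatrix_fact (n : ℕ) (γ : ℝ) [hγ : Fact (0 < γ)] :
    Fact (ballKernelMatrix n γ).PosSemidef :=
  ⟨ballKernelMatrix_posSemidef n hγ.out⟩

/-- The Hilbert space `H_γ` of functions on the unit ball with reproducing kernel `K^γ`: the
completion of the span of the kernel functions. Its elements act as functions through
`RKHS.instFunLike`. -/
abbrev BallHilbertSpace (n : ℕ) (γ : ℝ) [Fact (0 < γ)] : Type :=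
  RKHS.OfKernel (ballKernelMatrix n γ)

/-- The normalized reproducing kernel `k^γ_a(w) = (1 - |a|²)^(γ/2) / (1 - ⟨w, a⟩)^γ`. -/
noncomputable def normalizedKernel {n : ℕ} (γ : ℝ) (a w : UnitBall n) : ℂ :=
  (((1 - ‖(a : EuclideanSpace ℂ (Fin n))‖ ^ 2) ^ (γ / 2) : ℝ) : ℂ) /
    (1 - inner ℂ (a : EuclideanSpace ℂ (Fin n)) (w : EuclideanSpace ℂ (Fin n))) ^ (γ : ℂ)

/-- The weighted composition operator `W_{f,φ} h = f · (h ∘ φ)` on `H_γ`, with domain the set of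
all `h ∈ H_γ` for which `f · (h ∘ φ)` belongs to `H_γ`. -/
noncomputable def weightedComp {n : ℕ} (γ : ℝ) [Fact (0 < γ)] (f : UnitBall n → ℂ)
    (φ : UnitBall n → UnitBall n) : BallHilbertSpace n γ →ₗ.[ℂ] BallHilbertSpace n γ where
  domain :=
    { carrier := {h | ∃ u : BallHilbertSpace n γ, ∀ z, u z = f z * h (φ z)}
      zero_mem' := ⟨0, by simp⟩
      add_mem' := by
        rintro h₁ h₂ ⟨u₁, hu₁⟩ ⟨u₂, hu₂⟩
        exact ⟨u₁ + u₂, fun z => by simp [hu₁, hu₂, mul_add]⟩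
      smul_mem' := by
        rintro c h ⟨u, hu⟩
        exact ⟨c • u, fun z => by simp [hu, mul_left_comm]⟩ }
  toFun :=
    { toFun := fun h => h.2.choose
      map_add' := fun h₁ h₂ => by
        ext z
        rw [(h₁ + h₂).2.choose_spec z, RKHS.coe_add, Pi.add_apply, h₁.2.choose_spec z,
          h₂.2.choose_spec z]
        simp [mul_add]
      map_smul' := fun c h => by
        ext z
        rw [(c • h).2.choose_spec z, RKHS.coe_smul, Pi.smul_apply, RingHom.id_apply,
          h.2.choose_spec z]
        simp [mul_left_comm] }

/-- `S T* = I`, for possibly unbounded operators `S`, `T` on a Hilbert space: `T` is densely defined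
(so that `T*` exists), and the product `S T*`, with its natural domain
`{h ∈ dom T* : T* h ∈ dom S}`, is defined on the whole space and is the identity. -/
def MulAdjointEqOne {H : Type*} [NormedAddCommGroup H] [InnerProductSpace ℂ H] [CompleteSpace H]
    (S T : H →ₗ.[ℂ] H) : Prop :=
  Dense (T.domain : Set H) ∧
    ∀ h : H, ∃ (h₁ : h ∈ T†.domain) (h₂ : T† ⟨h, h₁⟩ ∈ S.domain), S ⟨T† ⟨h, h₁⟩, h₂⟩ = h

/-- The operator `T` is everywhere defined, bounded and unitary. -/
def IsUnitaryOperator {H : Type*} [NormedAddCommGroup H] [InnerProductSpace ℂ H] [CompleteSpace H]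
    (T : H →ₗ.[ℂ] H) : Prop :=
  ∃ U ∈ unitary (H →L[ℂ] H), T = (U : H →ₗ[ℂ] H).toPMap ⊤

/-! Testing the operator identity on reproducing kernels turns it into the scalar identity `f w *
conj (g z) * K(φ w, ψ z) = K(w, z)` (`MulAdjointEqOne.kernel_identity`), which alone drives the
forward direction. Comparing the pairs `(w, z)`, `(w, 0)`, `(0, z)`, `(0, 0)` eliminates `f` and
`g`; taking norms and `γ`-th roots removes the power (`norm_identity_of_kernel_identity`). On the
diagonal `z = w` this forces `|1 - ⟨φ w, ψ w⟩| = O(1 - |w|²)`, so `φ - ψ` vanishes at the boundary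
and hence everywhere, by the maximum principle. With `φ = ψ` and `b = φ 0`, the same identity says
that the involution exchanging `0` and `b`, composed with `φ`, preserves norms; the equality case of
the Schwarz lemma makes it a linear isometry, so `φ` is an automorphism. Setting one variable to `a
= φ⁻¹ 0` then reads off `f` and `g`.

Conversely, every automorphism is an isometry after an involution, so it transforms the kernel with
multiplier `k^γ_a`. Hence `K_z ↦ conj (k^γ_a z) • K_{φ z}` preserves inner products and extends to a
unitary whose inverse is `W_{k^γ_a, φ}`; the reciprocal constants in `f` and `g` cancel in the
product. -/

section BallInvolution

/-! ### Involutions of the ball and norm preserving holomorphic maps. -/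

variable {E : Type*} [NormedAddCommGroup E] [InnerProductSpace ℂ E]

/-- The involution `z ↦ (a - P z - s Q z) / (1 - ⟨z, a⟩)` of the unit ball exchanging `0` and `a`,
where `P` is the orthogonal projection onto `ℂ a`, `Q = 1 - P` and `s = √(1 - |a|²)`. It is written
in a form that makes sense for `a = 0` too. -/
noncomputable def ballInvolution (a z : E) : E :=
  (1 - inner ℂ a z)⁻¹ • (a - ((√(1 - ‖a‖ ^ 2) : ℝ) : ℂ) • z -
    ((1 + ((√(1 - ‖a‖ ^ 2) : ℝ) : ℂ))⁻¹ * inner ℂ a z) • a)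

theorem norm_inner_lt_one_of_norm_lt_one {a z : E} (ha : ‖a‖ < 1) (hz : ‖z‖ < 1) :
    ‖inner ℂ a z‖ < 1 :=
  (norm_inner_le_norm a z).trans_lt (mul_lt_one_of_nonneg_of_lt_one_left (norm_nonneg _) ha hz.le)

theorem one_sub_inner_ne_zero {a z : E} (ha : ‖a‖ < 1) (hz : ‖z‖ < 1) :
    1 - inner ℂ a z ≠ 0 := by
  intro h
  have := norm_inner_lt_one_of_norm_lt_one ha hz
  rw [← sub_eq_zero.mp h] at this
  simp at this

theorem ofReal_sqrt_one_sub_sq {E : Type*} [NormedAddCommGroup E] {a : E} (ha : ‖a‖ < 1) :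
    (((√(1 - ‖a‖ ^ 2) : ℝ) : ℂ)) ^ 2 = 1 - (‖a‖ : ℂ) ^ 2 := by
  rw [← Complex.ofReal_pow, Real.sq_sqrt (by nlinarith [norm_nonneg a])]
  push_cast
  rfl

theorem one_add_ofReal_sqrt_ne_zero (x : ℝ) : 1 + ((√x : ℝ) : ℂ) ≠ 0 := by
  have : (0 : ℝ) < 1 + √x := by positivity
  exact_mod_cast this.ne'

theorem ballInvolution_zero (a : E) : ballInvolution a 0 = a := by
  simp [ballInvolution]

/-- A rational identity in `s`, `⟨a, w⟩`, `⟨z, a⟩`, `⟨z, w⟩` once `|a|²` is replaced by `1 - s²`.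
Its diagonal shows that the ball is preserved; its polarized form gives the transformation of the
kernel. -/
theorem one_sub_inner_ballInvolution {a z w : E} (ha : ‖a‖ < 1) (hz : ‖z‖ < 1) (hw : ‖w‖ < 1) :
    1 - inner ℂ (ballInvolution a z) (ballInvolution a w) =
      (1 - (‖a‖ : ℂ) ^ 2) * (1 - inner ℂ z w) / ((1 - inner ℂ a w) * (1 - inner ℂ z a)) := by
  have h₁ := one_sub_inner_ne_zero ha hw
  have h₂ := one_sub_inner_ne_zero hz ha
  have hs := ofReal_sqrt_one_sub_sq ha
  have h₃ := one_add_ofReal_sqrt_ne_zero (1 - ‖a‖ ^ 2)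
  simp only [ballInvolution, inner_smul_left, inner_smul_right, inner_sub_left, inner_sub_right,
    map_inv₀, map_sub, map_mul, map_add, map_one, inner_conj_symm, Complex.conj_ofReal,
    inner_self_eq_norm_sq_to_K, Complex.coe_algebraMap]
  generalize ((√(1 - ‖a‖ ^ 2) : ℝ) : ℂ) = s at *
  generalize inner ℂ a w = x at *
  generalize inner ℂ z a = y at *
  generalize inner ℂ z w = q at *
  have hn : (‖a‖ : ℂ) ^ 2 = 1 - s ^ 2 := by rw [hs]; ring
  rw [hn]
  field_simp
  ring

theorem ballInvolution_involutive {a z : E} (ha : ‖a‖ < 1) (hz : ‖z‖ < 1) :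
    ballInvolution a (ballInvolution a z) = z := by
  have h₁ := one_sub_inner_ne_zero ha hz
  have hs := ofReal_sqrt_one_sub_sq ha
  have h₃ := one_add_ofReal_sqrt_ne_zero (1 - ‖a‖ ^ 2)
  have h₄ : ((√(1 - ‖a‖ ^ 2) : ℝ) : ℂ) ≠ 0 := by
    have : (0 : ℝ) < √(1 - ‖a‖ ^ 2) := Real.sqrt_pos.mpr (by nlinarith [norm_nonneg a])
    exact_mod_cast this.ne'
  have hin : 1 - inner ℂ a (ballInvolution a z) =
      (((√(1 - ‖a‖ ^ 2) : ℝ) : ℂ)) ^ 2 / (1 - inner ℂ a z) := by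
    simp only [ballInvolution, inner_smul_right, inner_sub_right, inner_self_eq_norm_sq_to_K,
      Complex.coe_algebraMap]
    generalize ((√(1 - ‖a‖ ^ 2) : ℝ) : ℂ) = s at *
    have hn : (‖a‖ : ℂ) ^ 2 = 1 - s ^ 2 := by rw [hs]; ring
    rw [hn]
    field_simp
    ring
  have hin' : inner ℂ a (ballInvolution a z) =
      1 - (((√(1 - ‖a‖ ^ 2) : ℝ) : ℂ)) ^ 2 / (1 - inner ℂ a z) := by rw [← hin]; ring
  rw [ballInvolution, hin', sub_sub_cancel, ballInvolution]
  generalize ((√(1 - ‖a‖ ^ 2) : ℝ) : ℂ) = s at *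
  generalize inner ℂ a z = x at *
  match_scalars
  · field_simp
    ring
  · field_simp

theorem norm_ballInvolution_lt_one {a z : E} (ha : ‖a‖ < 1) (hz : ‖z‖ < 1) :
    ‖ballInvolution a z‖ < 1 := by
  have h := one_sub_inner_ballInvolution ha hz hz
  have hc : (1 - inner ℂ a z) * (1 - inner ℂ z a) = ((‖1 - inner ℂ a z‖ ^ 2 : ℝ) : ℂ) := by
    rw [← Complex.normSq_eq_norm_sq, ← Complex.mul_conj]
    simp
  rw [hc, inner_self_eq_norm_sq_to_K, inner_self_eq_norm_sq_to_K] at h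
  simp only [Complex.coe_algebraMap] at h
  have h' : 1 - ‖ballInvolution a z‖ ^ 2 =
      (1 - ‖a‖ ^ 2) * (1 - ‖z‖ ^ 2) / ‖1 - inner ℂ a z‖ ^ 2 := by exact_mod_cast h
  have hpos : 0 < (1 - ‖a‖ ^ 2) * (1 - ‖z‖ ^ 2) / ‖1 - inner ℂ a z‖ ^ 2 := by
    have := norm_pos_iff.mpr (one_sub_inner_ne_zero ha hz)
    have h₁ : 0 < 1 - ‖a‖ ^ 2 := by nlinarith [norm_nonneg a]
    have h₂ : 0 < 1 - ‖z‖ ^ 2 := by nlinarith [norm_nonneg z]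
    positivity
  rw [← h'] at hpos
  nlinarith [norm_nonneg (ballInvolution a z)]

theorem analyticOnNhd_ballInvolution {a : E} (ha : ‖a‖ < 1) :
    AnalyticOnNhd ℂ (ballInvolution a) (Metric.ball 0 1) := by
  intro z hz
  have h := one_sub_inner_ne_zero ha (mem_ball_zero_iff.mp hz)
  have hi : AnalyticAt ℂ (fun z : E => inner ℂ a z) z := (innerSL ℂ a).analyticAt z
  unfold ballInvolution
  exact ((analyticAt_const.sub hi).inv h).smul
    ((analyticAt_const.sub (analyticAt_const.smul analyticAt_id)).sub
      ((analyticAt_const.mul hi).smul analyticAt_const))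

/-- A norm preserving holomorphic map on the unit ball is linear. -/
theorem eq_fderiv_of_norm_eq {F : E → E}
    (hF : DifferentiableOn ℂ F (Metric.ball 0 1)) (hn : ∀ z, ‖z‖ < 1 → ‖F z‖ = ‖z‖)
    {z : E} (hz : ‖z‖ < 1) : F z = fderiv ℂ F 0 z := by
  have : StrictConvexSpace ℝ E :=
    let _ : InnerProductSpace ℝ E := InnerProductSpace.complexToReal
    inferInstance
  have hF0 : F 0 = 0 := by simpa using hn 0 (by simp)
  rcases eq_or_ne z 0 with rfl | hz0
  · simpa using hF0
  have hzpos := norm_pos_iff.mpr hz0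
  have hmaps : Set.MapsTo (fun ζ : ℂ => ζ • z) (Metric.ball 0 (1 / ‖z‖)) (Metric.ball 0 1) := by
    intro ζ hζ
    rw [mem_ball_zero_iff] at hζ ⊢
    rwa [norm_smul, ← lt_div_iff₀ hzpos]
  have hd : DifferentiableOn ℂ (fun ζ : ℂ => F (ζ • z)) (Metric.ball 0 (1 / ‖z‖)) :=
    hF.comp (by fun_prop) hmaps
  have h1 : (1 : ℂ) ∈ Metric.ball (0 : ℂ) (1 / ‖z‖) := by
    rw [mem_ball_zero_iff, norm_one, lt_div_iff₀ hzpos]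
    simpa using hz
  have hslope : dslope (fun ζ : ℂ => F (ζ • z)) 0 1 = F z := by
    rw [dslope_of_ne _ one_ne_zero]
    simp [slope, hF0]
  -- The slice `ζ ↦ F (ζ • z)` maps the disc of radius `1 / ‖z‖` to the unit ball and attains the
  -- Schwarz bound at `ζ = 1`; strict convexity of the target then makes it affine.
  have haff := Complex.affine_of_mapsTo_ball_of_norm_dslope_eq_div (R₂ := 1) hd
    (fun ζ hζ => by
      have := mem_ball_zero_iff.mp (hmaps hζ)
      simpa [hF0, hn _ this] using this.le) h1 (by rw [hslope, hn z hz]; simp)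
  have hder : HasDerivAt (fun ζ : ℂ => F (ζ • z)) (fderiv ℂ F 0 z) 0 := by
    have h₁ : HasFDerivAt F (fderiv ℂ F 0) ((0 : ℂ) • z) := by
      rw [zero_smul]
      exact (hF.differentiableAt (Metric.ball_mem_nhds 0 one_pos)).hasFDerivAt
    have h₂ : HasDerivAt (fun ζ : ℂ => ζ • z) z 0 := by
      simpa using (hasDerivAt_id (0 : ℂ)).smul_const z
    exact h₁.comp_hasDerivAt 0 h₂
  have hder' : HasDerivAt (fun ζ : ℂ => F (ζ • z)) (F z) 0 := by
    have h₂ : HasDerivAt (fun ζ : ℂ => ζ • F z) (F z) 0 := by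
      simpa using (hasDerivAt_id (0 : ℂ)).smul_const (F z)
    refine h₂.congr_of_eventuallyEq ?_
    filter_upwards [Metric.ball_mem_nhds (0 : ℂ) (by positivity : 0 < 1 / ‖z‖)] with ζ hζ
    simpa [hF0, hslope] using haff hζ
  exact hder'.unique hder

theorem exists_linearIsometryEquiv_of_norm_eq [FiniteDimensional ℂ E] {F : E → E}
    (hF : DifferentiableOn ℂ F (Metric.ball 0 1)) (hn : ∀ z, ‖z‖ < 1 → ‖F z‖ = ‖z‖) :
    ∃ L : E ≃ₗᵢ[ℂ] E, ∀ z, ‖z‖ < 1 → F z = L z := by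
  have hiso (z : E) : ‖fderiv ℂ F 0 z‖ = ‖z‖ := by
    -- Scaling by `(1 + ‖z‖)⁻¹` moves an arbitrary `z` into the ball; linearity of the derivative
    -- scales back.
    have hpos : 0 < 1 + ‖z‖ := by positivity
    have hsmall : ‖(((1 + ‖z‖)⁻¹ : ℝ) : ℂ) • z‖ < 1 := by
      rw [norm_smul, Complex.norm_real, Real.norm_of_nonneg (by positivity), inv_mul_lt_one₀ hpos]
      linarith
    have := hn _ hsmall
    rw [eq_fderiv_of_norm_eq hF hn hsmall, map_smul, norm_smul, norm_smul, Complex.norm_real,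
      Real.norm_of_nonneg (by positivity)] at this
    exact mul_left_cancel₀ (by positivity) this
  let L : E →ₗᵢ[ℂ] E := ⟨(fderiv ℂ F 0).toLinearMap, hiso⟩
  exact ⟨L.toLinearIsometryEquiv rfl, fun z hz => eq_fderiv_of_norm_eq hF hn hz⟩

end BallInvolution

/-! ### Automorphisms of the ball. -/

namespace UnitBall

variable {n : ℕ}

theorem norm_lt_one (z : UnitBall n) : ‖(z : EuclideanSpace ℂ (Fin n))‖ < 1 :=
  mem_ball_zero_iff.mp z.2

theorem one_sub_norm_sq_pos (z : UnitBall n) : 0 < 1 - ‖(z : EuclideanSpace ℂ (Fin n))‖ ^ 2 := by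
  nlinarith [z.norm_lt_one, norm_nonneg (z : EuclideanSpace ℂ (Fin n))]

/-- The involution `ballInvolution a` as a self-map of the unit ball. -/
noncomputable def involution (a z : UnitBall n) : UnitBall n :=
  ⟨ballInvolution a.1 z.1,
    mem_ball_zero_iff.mpr (norm_ballInvolution_lt_one a.norm_lt_one z.norm_lt_one)⟩

theorem involution_involution (a z : UnitBall n) : involution a (involution a z) = z :=
  Subtype.ext (ballInvolution_involutive a.norm_lt_one z.norm_lt_one)

theorem involution_center (a : UnitBall n) : involution a (center n) = a :=
  Subtype.ext (ballInvolution_zero a.1)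

theorem involution_self (a : UnitBall n) : involution a a = center n := by
  conv_lhs => rw [← involution_center a, involution_center a]
  rw [← involution_involution a (center n), involution_center]

theorem one_sub_inner_involution (a z w : UnitBall n) :
    1 - inner ℂ (involution a z).1 (involution a w).1 =
      (1 - (‖a.1‖ : ℂ) ^ 2) * (1 - inner ℂ z.1 w.1) /
        ((1 - inner ℂ a.1 w.1) * (1 - inner ℂ z.1 a.1)) :=
  one_sub_inner_ballInvolution a.norm_lt_one z.norm_lt_one w.norm_lt_one

theorem analyticSelfMap_involution (a : UnitBall n) : AnalyticSelfMap (involution a) :=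
  ⟨ballInvolution a.1, analyticOnNhd_ballInvolution a.norm_lt_one, fun _ => rfl⟩

/-- A linear isometry as a self-map of the unit ball. -/
noncomputable def ofLinearIsometryEquiv
    (L : EuclideanSpace ℂ (Fin n) ≃ₗᵢ[ℂ] EuclideanSpace ℂ (Fin n)) (z : UnitBall n) : UnitBall n :=
  ⟨L z.1, by simpa using z.norm_lt_one⟩

theorem analyticSelfMap_ofLinearIsometryEquiv
    (L : EuclideanSpace ℂ (Fin n) ≃ₗᵢ[ℂ] EuclideanSpace ℂ (Fin n)) :
    AnalyticSelfMap (ofLinearIsometryEquiv L) :=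
  ⟨L, fun z _ => L.toContinuousLinearEquiv.analyticAt z, fun _ => rfl⟩

end UnitBall

open UnitBall

variable {n : ℕ} {φ ψ : UnitBall n → UnitBall n}

theorem AnalyticSelfMap.comp (hφ : AnalyticSelfMap φ) (hψ : AnalyticSelfMap ψ) :
    AnalyticSelfMap (φ ∘ ψ) := by
  obtain ⟨F, hF, hFφ⟩ := hφ
  obtain ⟨G, hG, hGψ⟩ := hψ
  refine ⟨F ∘ G, fun z hz => ?_, fun z => ?_⟩
  · refine AnalyticAt.comp ?_ (hG z hz)
    rw [hGψ ⟨z, hz⟩]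
    exact hF _ (ψ ⟨z, hz⟩).2
  · simp [hGψ, hFφ]

/-- The Schwarz lemma on the ball. -/
theorem AnalyticSelfMap.norm_le (hφ : AnalyticSelfMap φ) (h0 : φ (center n) = center n)
    (z : UnitBall n) : ‖(φ z).1‖ ≤ ‖z.1‖ := by
  obtain ⟨F, hF, hFφ⟩ := hφ
  rw [← show F z = (φ z).1 from hFφ z]
  refine Complex.norm_le_norm_of_mapsTo_ball hF.differentiableOn (fun w hw => ?_) ?_ z.norm_lt_one
  · rw [hFφ ⟨w, hw⟩, mem_closedBall_zero_iff]
    exact (φ ⟨w, hw⟩).norm_lt_one.le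
  · exact (hFφ (center n)).trans (congrArg Subtype.val h0)

/-- A norm preserving analytic self-map of the ball is a linear isometry. -/
theorem AnalyticSelfMap.exists_linearIsometryEquiv (hφ : AnalyticSelfMap φ)
    (hn : ∀ z, ‖(φ z).1‖ = ‖z.1‖) :
    ∃ L : EuclideanSpace ℂ (Fin n) ≃ₗᵢ[ℂ] EuclideanSpace ℂ (Fin n),
      φ = ofLinearIsometryEquiv L := by
  obtain ⟨F, hF, hFφ⟩ := hφ
  obtain ⟨L, hL⟩ := exists_linearIsometryEquiv_of_norm_eq hF.differentiableOn fun z hz =>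
    (congrArg norm (hFφ ⟨z, mem_ball_zero_iff.mpr hz⟩)).trans (hn ⟨z, mem_ball_zero_iff.mpr hz⟩)
  exact ⟨L, funext fun z => Subtype.ext ((hFφ z).symm.trans (hL z z.norm_lt_one))⟩

/-- An automorphism of the ball sending `a` to `0` is a linear isometry composed with the
involution exchanging `0` and `a`. -/
theorem IsBallAutomorphism.exists_linearIsometryEquiv (hφ : IsBallAutomorphism φ) {a : UnitBall n}
    (ha : φ a = center n) :
    ∃ L : EuclideanSpace ℂ (Fin n) ≃ₗᵢ[ℂ] EuclideanSpace ℂ (Fin n),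
      φ = ofLinearIsometryEquiv L ∘ involution a := by
  obtain ⟨hφ, χ, hχ, hl, hr⟩ := hφ
  have hF := hφ.comp (analyticSelfMap_involution a)
  have hG := (analyticSelfMap_involution a).comp hχ
  -- Both `φ ∘ involution a` and its inverse fix the centre, so the Schwarz lemma applied to each
  -- gives equality of norms.
  obtain ⟨L, hL⟩ := hF.exists_linearIsometryEquiv fun z => by
    refine le_antisymm (hF.norm_le (by simp [involution_center, ha]) z) ?_
    have hχ0 : χ (center n) = a := by rw [← ha, hl]
    have := hG.norm_le (by simp [hχ0, involution_self]) ((φ ∘ involution a) z)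
    simpa [hl _, involution_involution] using this
  refine ⟨L, ?_⟩
  rw [← hL]
  funext z
  simp [involution_involution]

theorem IsBallAutomorphism.one_sub_inner (hφ : IsBallAutomorphism φ) {a : UnitBall n}
    (ha : φ a = center n) (z w : UnitBall n) :
    1 - inner ℂ (φ z).1 (φ w).1 = (1 - (‖a.1‖ : ℂ) ^ 2) * (1 - inner ℂ z.1 w.1) /
        ((1 - inner ℂ a.1 w.1) * (1 - inner ℂ z.1 a.1)) := by
  obtain ⟨L, rfl⟩ := hφ.exists_linearIsometryEquiv ha
  rw [← one_sub_inner_involution]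
  simp [ofLinearIsometryEquiv]

theorem isBallAutomorphism_involution_comp (b : UnitBall n)
    (L : EuclideanSpace ℂ (Fin n) ≃ₗᵢ[ℂ] EuclideanSpace ℂ (Fin n)) :
    IsBallAutomorphism (involution b ∘ ofLinearIsometryEquiv L) :=
  ⟨(analyticSelfMap_involution b).comp (analyticSelfMap_ofLinearIsometryEquiv L),
    ofLinearIsometryEquiv L.symm ∘ involution b,
    (analyticSelfMap_ofLinearIsometryEquiv L.symm).comp (analyticSelfMap_involution b),
    fun z => by simp [involution_involution, ofLinearIsometryEquiv],
    fun z => by simp [involution_involution, ofLinearIsometryEquiv]⟩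

/-! ### Weighted composition operators and their action on kernels. -/

section Operators

variable {n : ℕ} (γ : ℝ) [Fact (0 < γ)]

/-- The kernel function `K^γ(·, z)` as an element of `H_γ`. -/
noncomputable def kernelFunction (z : UnitBall n) : BallHilbertSpace n γ :=
  RKHS.kerFun (BallHilbertSpace n γ) z (1 : ℂ)

theorem kernelFunction_apply (z w : UnitBall n) : kernelFunction γ z w = ballKernel γ w z := by
  rw [kernelFunction, RKHS.kerFun_apply, RKHS.OfKernel.kernel_ofKernel]
  simp [ballKernelMatrix]

theorem inner_kernelFunction (z : UnitBall n) (h : BallHilbertSpace n γ) :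
    inner ℂ (kernelFunction γ z) h = h z := by
  rw [kernelFunction, RKHS.kerFun_inner]
  simp

theorem span_kernelFunction_dense :
    (Submodule.span ℂ (Set.range (kernelFunction (n := n) γ))).topologicalClosure = ⊤ := by
  rw [eq_top_iff, ← RKHS.kerFun_dense (𝕜 := ℂ) (BallHilbertSpace n γ)]
  refine Submodule.topologicalClosure_mono (Submodule.span_le.mpr ?_)
  rintro _ ⟨z, v, rfl⟩
  have : RKHS.kerFun (BallHilbertSpace n γ) z v = v • kernelFunction γ z := by
    rw [kernelFunction, ← map_smul]
    simp
  rw [this]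
  exact Submodule.smul_mem _ _ (Submodule.subset_span ⟨z, rfl⟩)

variable {γ}

theorem ballKernel_ne_zero {n : ℕ} {γ : ℝ} (w z : UnitBall n) : ballKernel γ w z ≠ 0 := by
  rw [ballKernel]
  refine one_div_ne_zero ?_
  rw [Complex.cpow_ne_zero_iff]
  exact Or.inl (Complex.slitPlane_ne_zero (one_sub_inner_mem_slitPlane z w))

/-- A weighted composition operator whose symbols intertwine the kernel, with nonvanishing weight
and surjective composition symbol, is unitary. -/
theorem isUnitaryOperator_weightedComp {k : UnitBall n → ℂ} {φ : UnitBall n → UnitBall n}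
    (hk : ∀ z, k z ≠ 0) (hφ : Function.Surjective φ)
    (hK : ∀ w z, k w * conj (k z) * ballKernel γ (φ w) (φ z) = ballKernel γ w z) :
    IsUnitaryOperator (weightedComp γ k φ) := by
  let v (z : UnitBall n) : BallHilbertSpace n γ := conj (k z) • kernelFunction γ (φ z)
  have hinner (z w : UnitBall n) :
      inner ℂ (v z) (v w) = inner ℂ (kernelFunction γ z) (kernelFunction γ w) := by
    simp only [v, inner_smul_left, inner_smul_right, inner_kernelFunction, kernelFunction_apply,
      Complex.conj_conj, ← hK z w]
    ring
  -- Formal combinations of points parametrize both dense spans, so the isometry needs no separate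
  -- check that it respects linear relations among kernel functions.
  let e₁ : (UnitBall n →₀ ℂ) →ₗ[ℂ] BallHilbertSpace n γ :=
    Finsupp.linearCombination ℂ (kernelFunction γ)
  let e₂ : (UnitBall n →₀ ℂ) →ₗ[ℂ] BallHilbertSpace n γ := Finsupp.linearCombination ℂ v
  have hd₁ : DenseRange e₁ := by
    have h := span_kernelFunction_dense (n := n) γ
    rw [← Finsupp.range_linearCombination, ← Submodule.dense_iff_topologicalClosure_eq_top] at h
    exact h
  have hd₂ : DenseRange e₂ := by
    have hs : Submodule.span ℂ (Set.range v) =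
        Submodule.span ℂ (Set.range (kernelFunction (n := n) γ)) := by
      refine le_antisymm (Submodule.span_le.mpr ?_) (Submodule.span_le.mpr ?_)
      · rintro _ ⟨z, rfl⟩
        exact Submodule.smul_mem _ _ (Submodule.subset_span ⟨φ z, rfl⟩)
      · rintro _ ⟨w, rfl⟩
        obtain ⟨z, rfl⟩ := hφ w
        have : kernelFunction γ (φ z) = (conj (k z))⁻¹ • v z := by
          rw [smul_smul, inv_mul_cancel₀ (by simpa using hk z), one_smul]
        rw [this]
        exact Submodule.smul_mem _ _ (Submodule.subset_span ⟨z, rfl⟩)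
    have h := span_kernelFunction_dense (n := n) γ
    rw [← hs, ← Finsupp.range_linearCombination,
      ← Submodule.dense_iff_topologicalClosure_eq_top] at h
    exact h
  have hnorm (c : UnitBall n →₀ ℂ) : ‖e₂ (LinearEquiv.refl ℂ _ c)‖ = ‖e₁ c‖ := by
    have : inner ℂ (e₂ c) (e₂ c) = inner ℂ (e₁ c) (e₁ c) := by
      simp only [e₁, e₂, Finsupp.linearCombination_apply, Finsupp.sum_inner, Finsupp.inner_sum,
        inner_smul_left, inner_smul_right, hinner]
    rw [inner_self_eq_norm_sq_to_K, inner_self_eq_norm_sq_to_K] at this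
    have h : ‖e₂ c‖ ^ 2 = ‖e₁ c‖ ^ 2 := by exact_mod_cast this
    simpa using h
  let V := (LinearEquiv.refl ℂ (UnitBall n →₀ ℂ)).extendOfIsometry e₁ e₂ hd₁ hd₂ hnorm
  have hV (z : UnitBall n) : V (kernelFunction γ z) = v z := by
    have := (LinearEquiv.refl ℂ (UnitBall n →₀ ℂ)).extendOfIsometry_eq e₁ e₂ hd₁ hd₂ hnorm
      (Finsupp.single z 1)
    simpa [e₁, e₂] using this
  -- `V` acts on kernels as the adjoint of the weighted composition, so its inverse is the weighted
  -- composition itself, which therefore has full domain.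
  have hW (h : BallHilbertSpace n γ) (z : UnitBall n) : V.symm h z = k z * h (φ z) := by
    rw [← inner_kernelFunction, ← V.inner_map_map, hV, V.apply_symm_apply]
    simp only [v, inner_smul_left, Complex.conj_conj, inner_kernelFunction]
  refine ⟨Unitary.linearIsometryEquiv.symm V.symm,
    (Unitary.linearIsometryEquiv.symm V.symm).2, ?_⟩
  · refine LinearPMap.ext ?_ fun x hx hx' => ?_
    · ext h
      simp only [LinearMap.toPMap_domain, Submodule.mem_top, iff_true]
      exact ⟨V.symm h, hW h⟩
    · ext z
      exact (hx.choose_spec z).trans (hW x z).symm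

theorem weightedComp_apply (f : UnitBall n → ℂ) (φ : UnitBall n → UnitBall n)
    (h : (weightedComp γ f φ).domain) (z : UnitBall n) :
    weightedComp γ f φ h z = f z * (h : BallHilbertSpace n γ) (φ z) :=
  h.2.choose_spec z

/-- Nonvanishing of `c` matters for the domains: weight zero has full domain, while `0 • W` keeps
the domain of `W`. -/
theorem weightedComp_smul {c : ℂ} (hc : c ≠ 0) (f : UnitBall n → ℂ)
    (φ : UnitBall n → UnitBall n) : weightedComp γ (c • f) φ = c • weightedComp γ f φ := by
  refine LinearPMap.ext ?_ fun x hx hx' => ?_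
  · ext h
    rw [LinearPMap.smul_domain]
    constructor
    · rintro ⟨u, hu⟩
      refine ⟨c⁻¹ • u, fun z => ?_⟩
      simp [hu, ← mul_assoc, hc]
    · rintro ⟨u, hu⟩
      exact ⟨c • u, fun z => by simp [hu, mul_assoc]⟩
  · ext z
    rw [LinearPMap.smul_apply, RKHS.coe_smul, Pi.smul_apply, weightedComp_apply,
      weightedComp_apply]
    simp [mul_assoc]

/-- The adjoint of a weighted composition operator maps `K_z` to `conj (g z) K_{ψ z}`. -/
theorem weightedComp_adjoint_kernelFunction {g : UnitBall n → ℂ} {ψ : UnitBall n → UnitBall n}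
    (hd : Dense ((weightedComp γ g ψ).domain : Set (BallHilbertSpace n γ))) (z : UnitBall n)
    (hz : kernelFunction γ z ∈ (weightedComp γ g ψ)†.domain) :
    (weightedComp γ g ψ)† ⟨kernelFunction γ z, hz⟩ = conj (g z) • kernelFunction γ (ψ z) := by
  refine LinearPMap.adjoint_apply_eq hd _ fun h => ?_
  rw [inner_smul_left, inner_kernelFunction, inner_kernelFunction, weightedComp_apply,
    Complex.conj_conj]

/-- Evaluate the operator identity for `K_z` at the point `w`. No boundedness is needed, since the
hypothesis already puts `K_z` in the domain of the adjoint. -/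
theorem MulAdjointEqOne.kernel_identity {f g : UnitBall n → ℂ} {φ ψ : UnitBall n → UnitBall n}
    (h : MulAdjointEqOne (weightedComp γ f φ) (weightedComp γ g ψ)) (w z : UnitBall n) :
    f w * conj (g z) * ballKernel γ (φ w) (ψ z) = ballKernel γ w z := by
  obtain ⟨h₁, h₂, h₃⟩ := h.2 (kernelFunction γ z)
  have := congrArg (fun u : BallHilbertSpace n γ => u w) h₃
  simp only [weightedComp_apply, weightedComp_adjoint_kernelFunction h.1, RKHS.coe_smul,
    Pi.smul_apply, kernelFunction_apply, smul_eq_mul] at this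
  rw [← this, mul_assoc]

end Operators

theorem IsUnitaryOperator.mulAdjointEqOne {H : Type*} [NormedAddCommGroup H]
    [InnerProductSpace ℂ H] [CompleteSpace H] {T : H →ₗ.[ℂ] H} (hT : IsUnitaryOperator T) {c : ℂ}
    (hc : c ≠ 0) : MulAdjointEqOne (c • T) ((1 / conj c) • T) := by
  obtain ⟨U, hU, rfl⟩ := hT
  have hd : Dense (((1 / conj c) • (U : H →ₗ[ℂ] H).toPMap ⊤).domain : Set H) := by
    simp [LinearPMap.smul_domain]
  refine ⟨hd, fun h => ?_⟩
  -- The adjoint of `(1 / conj c) U` is `(1 / c) U*`, which supplies the vector witnessing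
  -- membership in its domain.
  have hx : ∀ x : ((1 / conj c) • (U : H →ₗ[ℂ] H).toPMap ⊤).domain,
      inner ℂ ((1 / c) • (star U) h) (x : H) =
        inner ℂ h (((1 / conj c) • (U : H →ₗ[ℂ] H).toPMap ⊤) x) := fun x => by
    change _ = inner ℂ h ((1 / conj c) • U (x : H))
    rw [inner_smul_left, inner_smul_right, ContinuousLinearMap.star_eq_adjoint,
      ContinuousLinearMap.adjoint_inner_left]
    simp
  have hmem := LinearPMap.mem_adjoint_domain_of_exists _ ⟨_, hx⟩
  refine ⟨hmem, Submodule.mem_top, ?_⟩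
  change c • U ((((1 / conj c) • (U : H →ₗ[ℂ] H).toPMap ⊤)†) ⟨h, hmem⟩) = h
  rw [LinearPMap.adjoint_apply_eq hd _ hx]
  have : U (star U h) = h := by
    simpa using congrArg (fun A : H →L[ℂ] H => A h) (Unitary.mul_star_self_of_mem hU)
  simp [this, hc]

/-- Principal powers are multiplicative here because the logarithms of the two sides differ by
`2πik`, while four arguments of size below `π / 2` leave a difference below `2π`; the positive `s`
contributes none. Hence `k = 0`. -/
theorem Complex.cpow_mul_cpow_mul_cpow_of_re_pos {p x y q : ℂ} {s : ℝ} (hp : 0 < p.re)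
    (hx : 0 < x.re) (hy : 0 < y.re) (hs : 0 < s) (hq : 0 < q.re) (h : p * x * y = s * q) (c : ℂ) :
    p ^ c * x ^ c * y ^ c = (s : ℂ) ^ c * q ^ c := by
  have hne {u : ℂ} (hu : 0 < u.re) : u ≠ 0 := by
    rintro rfl
    simp at hu
  have harg {u : ℂ} (hu : 0 < u.re) : |u.arg| < Real.pi / 2 :=
    Complex.abs_arg_lt_pi_div_two_iff.mpr (Or.inl hu)
  have hs' : (s : ℂ) ≠ 0 := by exact_mod_cast hs.ne'
  have hexp : Complex.exp (log p + log x + log y) = Complex.exp (log s + log q) := by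
    simp only [Complex.exp_add, Complex.exp_log (hne hp), Complex.exp_log (hne hx),
      Complex.exp_log (hne hy), Complex.exp_log hs', Complex.exp_log (hne hq), h]
  obtain ⟨k, hk⟩ := Complex.exp_eq_exp_iff_exists_int.mp hexp
  have him := congrArg Complex.im hk
  simp only [Complex.add_im, Complex.log_im, Complex.mul_im, Complex.intCast_re,
    Complex.intCast_im, Complex.mul_re, Complex.I_re, Complex.I_im, Complex.ofReal_re,
    Complex.ofReal_im, Complex.re_ofNat, Complex.im_ofNat, Complex.arg_ofReal_of_nonneg hs.le]
    at him
  ring_nf at him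
  have h₁ := abs_lt.mp (harg hp)
  have h₂ := abs_lt.mp (harg hx)
  have h₃ := abs_lt.mp (harg hy)
  have h₅ := abs_lt.mp (harg hq)
  have hpi := Real.pi_pos
  have hk1 : (k : ℝ) < 1 := by nlinarith
  have hk2 : (-1 : ℝ) < k := by nlinarith
  have hk0 : k = 0 := by
    have : k < 1 := by exact_mod_cast hk1
    have : -1 < k := by exact_mod_cast hk2
    omega
  rw [hk0, Int.cast_zero, zero_mul, add_zero] at hk
  simp only [Complex.cpow_def_of_ne_zero (hne hp), Complex.cpow_def_of_ne_zero (hne hx),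
    Complex.cpow_def_of_ne_zero (hne hy), Complex.cpow_def_of_ne_zero (hne hq),
    Complex.cpow_def_of_ne_zero hs', ← Complex.exp_add, ← add_mul, hk]

/-! ### Transformation of the kernel, and elimination of the weights. -/

section Kernel

variable {n : ℕ} {γ : ℝ}

theorem UnitBall.one_sub_inner_re_pos (z w : UnitBall n) : 0 < (1 - inner ℂ z.1 w.1).re := by
  have h := (Complex.re_le_norm _).trans_lt (norm_inner_lt_one z w)
  simpa using h

theorem ballKernel_center_right (w : UnitBall n) : ballKernel γ w (center n) = 1 := by
  simp [ballKernel, center]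

theorem ballKernel_center_left (z : UnitBall n) : ballKernel γ (center n) z = 1 := by
  simp [ballKernel, center]

theorem normalizedKernel_eq (a w : UnitBall n) :
    normalizedKernel γ a w = (((1 - ‖a.1‖ ^ 2) ^ (γ / 2) : ℝ) : ℂ) * ballKernel γ w a := by
  rw [normalizedKernel, ballKernel, mul_one_div]

theorem one_sub_norm_sq_rpow_half_sq (a : UnitBall n) :
    (((1 - ‖a.1‖ ^ 2) ^ (γ / 2) : ℝ) : ℂ) ^ 2 = ((1 - ‖a.1‖ ^ 2 : ℝ) : ℂ) ^ (γ : ℂ) := by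
  rw [← Complex.ofReal_cpow a.one_sub_norm_sq_pos.le, ← Complex.ofReal_pow, ← Real.rpow_natCast,
    ← Real.rpow_mul a.one_sub_norm_sq_pos.le]
  norm_num

theorem one_sub_norm_sq_rpow_half_ne_zero (a : UnitBall n) :
    (((1 - ‖a.1‖ ^ 2) ^ (γ / 2) : ℝ) : ℂ) ≠ 0 := by
  exact_mod_cast (Real.rpow_pos_of_pos a.one_sub_norm_sq_pos _).ne'

theorem normalizedKernel_ne_zero (a w : UnitBall n) : normalizedKernel γ a w ≠ 0 := by
  rw [normalizedKernel_eq]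
  exact mul_ne_zero (one_sub_norm_sq_rpow_half_ne_zero a) (ballKernel_ne_zero w a)

theorem rpow_sq_mul_ballKernel_self (a : UnitBall n) :
    (((1 - ‖a.1‖ ^ 2) ^ (γ / 2) : ℝ) : ℂ) ^ 2 * ballKernel γ a a = 1 := by
  rw [one_sub_norm_sq_rpow_half_sq, ballKernel, inner_self_eq_norm_sq_to_K, mul_one_div]
  simp only [Complex.coe_algebraMap]
  push_cast
  refine div_self ?_
  rw [Complex.cpow_ne_zero_iff]
  left
  exact_mod_cast a.one_sub_norm_sq_pos.ne'

/-- The kernel transforms under automorphisms with the multiplier `k^γ_a`. -/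
theorem IsBallAutomorphism.normalizedKernel_mul_ballKernel {φ : UnitBall n → UnitBall n}
    (hφ : IsBallAutomorphism φ) {a : UnitBall n} (ha : φ a = center n) (w z : UnitBall n) :
    normalizedKernel γ a w * conj (normalizedKernel γ a z) * ballKernel γ (φ w) (φ z) =
      ballKernel γ w z := by
  have hne (z w : UnitBall n) : (1 - inner ℂ z.1 w.1) ^ (γ : ℂ) ≠ 0 := by
    rw [Complex.cpow_ne_zero_iff]
    exact Or.inl (Complex.slitPlane_ne_zero (one_sub_inner_mem_slitPlane z w))
  have hp : (1 - inner ℂ (φ z).1 (φ w).1) * (1 - inner ℂ a.1 w.1) * (1 - inner ℂ z.1 a.1) =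
      ((1 - ‖a.1‖ ^ 2 : ℝ) : ℂ) * (1 - inner ℂ z.1 w.1) := by
    rw [hφ.one_sub_inner ha, mul_assoc, div_mul_cancel₀]
    · push_cast
      rfl
    · exact mul_ne_zero (Complex.slitPlane_ne_zero (one_sub_inner_mem_slitPlane a w))
        (Complex.slitPlane_ne_zero (one_sub_inner_mem_slitPlane z a))
  have h := Complex.cpow_mul_cpow_mul_cpow_of_re_pos (one_sub_inner_re_pos (φ z) (φ w))
    (one_sub_inner_re_pos a w) (one_sub_inner_re_pos z a) a.one_sub_norm_sq_pos
    (one_sub_inner_re_pos z w) hp γ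
  rw [normalizedKernel_eq, normalizedKernel_eq, map_mul, Complex.conj_ofReal, ballKernel_conj]
  have hs := one_sub_norm_sq_rpow_half_sq (γ := γ) a
  calc _ = (((1 - ‖a.1‖ ^ 2) ^ (γ / 2) : ℝ) : ℂ) ^ 2 *
        (ballKernel γ w a * ballKernel γ a z * ballKernel γ (φ w) (φ z)) := by ring
    _ = _ := by
      rw [hs]
      simp only [ballKernel]
      have h₁ := hne a w
      have h₂ := hne z a
      have h₃ := hne (φ z) (φ w)
      have h₄ := hne z w
      field_simp
      rw [← h]
      ring

theorem IsBallAutomorphism.isUnitaryOperator_weightedComp [Fact (0 < γ)]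
    {φ : UnitBall n → UnitBall n} (hφ : IsBallAutomorphism φ) {a : UnitBall n}
    (ha : φ a = center n) : IsUnitaryOperator (weightedComp γ (normalizedKernel γ a) φ) := by
  obtain ⟨χ, -, -, hr⟩ := hφ.2
  exact _root_.isUnitaryOperator_weightedComp (normalizedKernel_ne_zero a) hr.surjective
    (hφ.normalizedKernel_mul_ballKernel ha)

theorem norm_ballKernel (w z : UnitBall n) :
    ‖ballKernel γ w z‖ = (‖1 - inner ℂ z.1 w.1‖ ^ γ)⁻¹ := by
  rw [ballKernel, norm_div, norm_one, one_div, Complex.norm_cpow_real]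

variable {f g : UnitBall n → ℂ} {φ ψ : UnitBall n → UnitBall n}

/-- In the ratio of the `(w, z)`, `(0, 0)` instances to the `(w, 0)`, `(0, z)` instances all weights
cancel. Passing to norms avoids branches of the power, and `γ ≠ 0` allows the root. -/
theorem norm_identity_of_kernel_identity [hγ : Fact (0 < γ)]
    (h : ∀ w z, f w * conj (g z) * ballKernel γ (φ w) (ψ z) = ballKernel γ w z)
    (w z : UnitBall n) :
    ‖1 - inner ℂ z.1 w.1‖ * ‖1 - inner ℂ (ψ (center n)).1 (φ w).1‖ *
        ‖1 - inner ℂ (ψ z).1 (φ (center n)).1‖ =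
      ‖1 - inner ℂ (ψ z).1 (φ w).1‖ * ‖1 - inner ℂ (ψ (center n)).1 (φ (center n)).1‖ := by
  have h₁ := h w z
  have h₂ := h w (center n)
  have h₃ := h (center n) z
  have h₄ := h (center n) (center n)
  rw [ballKernel_center_right] at h₂ h₄
  rw [ballKernel_center_left] at h₃
  have hfg : f w * conj (g z) * (f (center n) * conj (g (center n))) ≠ 0 := by
    refine mul_ne_zero (fun h0 => ?_) fun h0 => ?_
    · rw [h0, zero_mul] at h₁
      exact ballKernel_ne_zero w z h₁.symm
    · rw [h0, zero_mul] at h₄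
      exact zero_ne_one h₄
  have key : ballKernel γ (φ w) (ψ z) * ballKernel γ (φ (center n)) (ψ (center n)) =
      ballKernel γ w z * (ballKernel γ (φ w) (ψ (center n)) * ballKernel γ (φ (center n)) (ψ z)) := by
    refine mul_left_cancel₀ hfg ?_
    linear_combination
      h₁ * (f (center n) * conj (g (center n)) * ballKernel γ (φ (center n)) (ψ (center n))) +
      ballKernel γ w z * h₄ -
      h₂ * (ballKernel γ w z * (f (center n) * conj (g z) * ballKernel γ (φ (center n)) (ψ z))) -
      ballKernel γ w z * h₃
  have hn := congrArg norm key
  simp only [norm_mul, norm_ballKernel, ← mul_inv, inv_inj] at hn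
  rw [← Real.mul_rpow (norm_nonneg _) (norm_nonneg _),
    ← Real.mul_rpow (norm_nonneg _) (norm_nonneg _),
    ← Real.mul_rpow (norm_nonneg _) (by positivity)] at hn
  rw [mul_assoc]
  refine ((Real.rpow_left_inj ?_ ?_ hγ.out.ne').mp hn).symm <;> positivity

end Kernel

/-- A holomorphic map on the unit ball that tends to zero at the boundary is zero. -/
theorem eq_zero_of_norm_sq_le {E F : Type*} [NormedAddCommGroup E] [NormedSpace ℂ E] [Nontrivial E]
    [NormedAddCommGroup F] [NormedSpace ℂ F] {D : E → F}
    (hD : DifferentiableOn ℂ D (Metric.ball 0 1)) {C : ℝ}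
    (hC : ∀ z, ‖z‖ < 1 → ‖D z‖ ^ 2 ≤ C * (1 - ‖z‖ ^ 2)) {z : E} (hz : ‖z‖ < 1) : D z = 0 := by
  -- Maximum principle on the ball of radius `r`, with `z` fixed; afterwards `r → 1`.
  have hr : ∀ᶠ r : ℝ in nhdsWithin 1 (Set.Iio 1), ‖D z‖ ^ 2 ≤ C * (1 - r ^ 2) := by
    have hz1 : max ‖z‖ (1 / 2) < 1 := max_lt hz (by norm_num)
    filter_upwards [Ioo_mem_nhdsLT hz1] with r hr
    have hr0 : 0 < r := by linarith [le_max_right ‖z‖ (1 / 2), hr.1]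
    have hzr : ‖z‖ < r := (le_max_left _ _).trans_lt hr.1
    have hsub : Metric.closedBall (0 : E) r ⊆ Metric.ball 0 1 :=
      Metric.closedBall_subset_ball hr.2
    have hd : DiffContOnCl ℂ D (Metric.ball 0 r) := by
      refine DifferentiableOn.diffContOnCl (hD.mono ?_)
      exact Metric.closure_ball_subset_closedBall.trans hsub
    have hfr : ∀ w ∈ frontier (Metric.ball (0 : E) r), ‖D w‖ ≤ √(C * (1 - r ^ 2)) := by
      intro w hw
      have hw' : ‖w‖ = r := by
        simpa using Metric.frontier_ball_subset_sphere hw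
      refine Real.le_sqrt_of_sq_le ?_
      rw [← hw']
      exact hC w (hw' ▸ hr.2)
    have hle := Complex.norm_le_of_forall_mem_frontier_norm_le Metric.isBounded_ball hd hfr
      (subset_closure (mem_ball_zero_iff.mpr hzr))
    have hpos : 0 ≤ C * (1 - r ^ 2) := by
      have h0 := (sq_nonneg _).trans (hC 0 (by simp))
      have hC0 : 0 ≤ C := by simpa using h0
      exact mul_nonneg hC0 (by nlinarith [hr.2])
    calc ‖D z‖ ^ 2 ≤ √(C * (1 - r ^ 2)) ^ 2 := by gcongr
      _ = _ := Real.sq_sqrt hpos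
  have hlim : Filter.Tendsto (fun r : ℝ => C * (1 - r ^ 2)) (nhdsWithin 1 (Set.Iio 1))
      (nhds (C * (1 - 1 ^ 2))) :=
    (Continuous.tendsto (by fun_prop) 1).mono_left nhdsWithin_le_nhds
  have := ge_of_tendsto hlim hr
  have h0 : ‖D z‖ ^ 2 ≤ 0 := by simpa using this
  exact norm_eq_zero.mp (pow_eq_zero_iff two_ne_zero |>.mp (le_antisymm h0 (sq_nonneg _)))

/-! ### Rigidity: the symbols coincide, are automorphisms, and determine the weights. -/

section Rigidity

variable {n : ℕ} {φ ψ : UnitBall n → UnitBall n}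

theorem UnitBall.norm_one_sub_inner_le_two (z w : UnitBall n) : ‖1 - inner ℂ z.1 w.1‖ ≤ 2 := by
  have h := norm_sub_le (1 : ℂ) (inner ℂ z.1 w.1)
  rw [norm_one] at h
  linarith [norm_inner_lt_one z w]

theorem UnitBall.norm_one_sub_inner_self (z : UnitBall n) :
    ‖1 - inner ℂ z.1 z.1‖ = 1 - ‖z.1‖ ^ 2 := by
  rw [inner_self_eq_norm_sq_to_K, ← Real.norm_of_nonneg z.one_sub_norm_sq_pos.le,
    ← Complex.norm_real]
  push_cast
  rfl

theorem UnitBall.norm_one_sub_inner_pos (z w : UnitBall n) : 0 < ‖1 - inner ℂ z.1 w.1‖ :=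
  norm_pos_iff.mpr (Complex.slitPlane_ne_zero (one_sub_inner_mem_slitPlane z w))

theorem AnalyticSelfMap.eq_of_norm_identity (hφ : AnalyticSelfMap φ) (hψ : AnalyticSelfMap ψ)
    (h : ∀ w : UnitBall n, ‖1 - inner ℂ w.1 w.1‖ * ‖1 - inner ℂ (ψ (center n)).1 (φ w).1‖ *
        ‖1 - inner ℂ (ψ w).1 (φ (center n)).1‖ =
      ‖1 - inner ℂ (ψ w).1 (φ w).1‖ * ‖1 - inner ℂ (ψ (center n)).1 (φ (center n)).1‖) :
    φ = ψ := by
  -- For `n = 0` the ball is a point and the maximum principle has no boundary to use.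
  rcases subsingleton_or_nontrivial (EuclideanSpace ℂ (Fin n)) with hs | hs
  · funext z
    exact Subtype.ext (Subsingleton.elim _ _)
  obtain ⟨F, hF, hFφ⟩ := hφ
  obtain ⟨G, hG, hGψ⟩ := hψ
  set m := ‖1 - inner ℂ (ψ (center n)).1 (φ (center n)).1‖
  have hm : 0 < m := norm_one_sub_inner_pos _ _
  -- One factor 2 comes from `|u - v|² ≤ 2 Re (1 - ⟨u, v⟩)` in the ball, the other two from bounding
  -- the off-diagonal factors of the identity.
  have hbound (w : UnitBall n) : ‖(φ w).1 - (ψ w).1‖ ^ 2 ≤ 8 / m * (1 - ‖w.1‖ ^ 2) := by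
    have h₁ : ‖(φ w).1 - (ψ w).1‖ ^ 2 ≤ 2 * ‖1 - inner ℂ (ψ w).1 (φ w).1‖ := by
      have hre := Complex.re_le_norm (1 - inner ℂ (ψ w).1 (φ w).1)
      rw [norm_sub_rev, norm_sub_sq (𝕜 := ℂ)]
      simp only [Complex.sub_re, Complex.one_re, RCLike.re_to_complex] at hre ⊢
      linarith [(φ w).one_sub_norm_sq_pos, (ψ w).one_sub_norm_sq_pos]
    have h₂ : ‖1 - inner ℂ (ψ w).1 (φ w).1‖ * m ≤ (1 - ‖w.1‖ ^ 2) * 2 * 2 := by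
      rw [← h w, norm_one_sub_inner_self]
      have := w.one_sub_norm_sq_pos
      gcongr <;> exact norm_one_sub_inner_le_two _ _
    rw [div_mul_eq_mul_div, le_div_iff₀ hm]
    nlinarith
  funext w
  refine Subtype.ext (sub_eq_zero.mp ?_)
  have := eq_zero_of_norm_sq_le (D := fun z => F z - G z) (C := 8 / m)
    (hF.differentiableOn.sub hG.differentiableOn) (fun z hz => by
      have hz' := mem_ball_zero_iff.mpr hz
      rw [show F z = _ from hFφ ⟨z, hz'⟩, show G z = _ from hGψ ⟨z, hz'⟩]
      exact hbound ⟨z, hz'⟩) w.norm_lt_one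
  simpa [hFφ, hGψ] using this

/-- With `b = φ 0`, the hypothesis is exactly `1 - |Φ_b (φ w)|² = 1 - |w|²` for the involution
`Φ_b`, so `Φ_b ∘ φ` is a linear isometry `L` and `φ = Φ_b ∘ L`. -/
theorem AnalyticSelfMap.isBallAutomorphism_of_norm_identity (hφ : AnalyticSelfMap φ)
    (h : ∀ w : UnitBall n, ‖1 - inner ℂ w.1 w.1‖ * ‖1 - inner ℂ (φ (center n)).1 (φ w).1‖ *
        ‖1 - inner ℂ (φ w).1 (φ (center n)).1‖ =
      ‖1 - inner ℂ (φ w).1 (φ w).1‖ * ‖1 - inner ℂ (φ (center n)).1 (φ (center n)).1‖) :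
    IsBallAutomorphism φ := by
  set b := φ (center n)
  obtain ⟨L, hL⟩ := ((analyticSelfMap_involution b).comp hφ).exists_linearIsometryEquiv
    fun z => by
      have h₁ := congrArg norm (one_sub_inner_involution b (φ z) (φ z))
      rw [norm_div, norm_mul, norm_mul, norm_one_sub_inner_self] at h₁
      have h₂ : ‖1 - (‖b.1‖ : ℂ) ^ 2‖ = ‖1 - inner ℂ b.1 b.1‖ := by
        rw [inner_self_eq_norm_sq_to_K]
        rfl
      rw [h₂, mul_comm ‖1 - inner ℂ b.1 b.1‖, ← h z, mul_assoc, mul_div_assoc, div_self,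
        mul_one, norm_one_sub_inner_self] at h₁
      · refine (sq_eq_sq₀ (norm_nonneg _) (norm_nonneg _)).mp ?_
        simp only [Function.comp_apply]
        linarith
      · exact (mul_pos (norm_one_sub_inner_pos _ _) (norm_one_sub_inner_pos _ _)).ne'
  have : φ = involution b ∘ ofLinearIsometryEquiv L := by
    rw [← hL]
    funext z
    simp [involution_involution]
  rw [this]
  exact isBallAutomorphism_involution_comp b L

theorem eq_smul_normalizedKernel_of_kernel_identity {γ : ℝ} {f g : UnitBall n → ℂ}
    (h : ∀ w z, f w * conj (g z) * ballKernel γ (φ w) (φ z) = ballKernel γ w z) {a : UnitBall n}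
    (ha : φ a = center n) :
    ∃ c : ℂ, c ≠ 0 ∧ f = c • normalizedKernel γ a ∧ g = (1 / conj c) • normalizedKernel γ a := by
  have hf (w : UnitBall n) : f w * conj (g a) = ballKernel γ w a := by
    simpa [ha, ballKernel_center_right] using h w a
  have hg (z : UnitBall n) : conj (f a) * g z = ballKernel γ z a := by
    have := congrArg conj (h a z)
    simpa [ha, ballKernel_center_left, ballKernel_conj] using this
  have hs := one_sub_norm_sq_rpow_half_ne_zero (γ := γ) a
  have hga : conj (g a) ≠ 0 := by
    intro h0
    have := hf a
    rw [h0, mul_zero] at this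
    exact ballKernel_ne_zero a a this.symm
  have hga' : g a ≠ 0 := by simpa using hga
  -- Forced by `f w * conj (g a) = K(w, a)` and `k^γ_a = (1 - |a|²)^(γ/2) K(·, a)`. That the same
  -- constant serves `g` rests on the normalization `(1 - |a|²)^γ K(a, a) = 1`.
  refine ⟨(conj (g a) * (((1 - ‖a.1‖ ^ 2) ^ (γ / 2) : ℝ) : ℂ))⁻¹, inv_ne_zero (mul_ne_zero hga hs),
    ?_, ?_⟩
  · funext w
    rw [Pi.smul_apply, normalizedKernel_eq, smul_eq_mul, ← hf]
    field_simp
  · funext z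
    rw [Pi.smul_apply, normalizedKernel_eq, smul_eq_mul, ← hg]
    simp only [map_inv₀, map_mul, Complex.conj_conj, Complex.conj_ofReal, one_div, inv_inv]
    have h₁ := rpow_sq_mul_ballKernel_self (γ := γ) a
    rw [← hg a] at h₁
    linear_combination (-g z) * h₁

end Rigidity

/-! ### The characterization. -/

theorem theorem3p5 (n : ℕ) (γ : ℝ) [Fact (0 < γ)]
    (f g : UnitBall n → ℂ) (φ ψ : UnitBall n → UnitBall n)
    (hf : AnalyticOnBall f) (hg : AnalyticOnBall g)
    (hφ : AnalyticSelfMap φ) (hψ : AnalyticSelfMap ψ) :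
    (MulAdjointEqOne (weightedComp γ f φ) (weightedComp γ g ψ) ↔
      φ = ψ ∧ IsBallAutomorphism φ ∧
        ∃ c : ℂ, c ≠ 0 ∧ ∃ a : UnitBall n, φ a = UnitBall.center n ∧
          f = c • normalizedKernel γ a ∧ g = (1 / conj c) • normalizedKernel γ a) ∧
    (MulAdjointEqOne (weightedComp γ f φ) (weightedComp γ g ψ) →
      ∃ a : UnitBall n, φ a = UnitBall.center n ∧
        IsUnitaryOperator (weightedComp γ (normalizedKernel γ a) φ) ∧
        (∃ c : ℂ, weightedComp γ f φ = c • weightedComp γ (normalizedKernel γ a) φ) ∧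
        (∃ d : ℂ, weightedComp γ g ψ = d • weightedComp γ (normalizedKernel γ a) φ)) := by
  have hforward (h : MulAdjointEqOne (weightedComp γ f φ) (weightedComp γ g ψ)) :
      φ = ψ ∧ IsBallAutomorphism φ ∧
        ∃ c : ℂ, c ≠ 0 ∧ ∃ a : UnitBall n, φ a = UnitBall.center n ∧
          f = c • normalizedKernel γ a ∧ g = (1 / conj c) • normalizedKernel γ a := by
    have hK := h.kernel_identity
    -- The diagonal suffices for both rigidity steps.
    have hN := fun w => norm_identity_of_kernel_identity hK w w
    obtain rfl := hφ.eq_of_norm_identity hψ hN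
    have haut := hφ.isBallAutomorphism_of_norm_identity hN
    obtain ⟨χ, -, -, hr⟩ := haut.2
    obtain ⟨c, hc, hfc, hgc⟩ := eq_smul_normalizedKernel_of_kernel_identity hK (hr (center n))
    exact ⟨rfl, haut, c, hc, _, hr (center n), hfc, hgc⟩
  refine ⟨⟨hforward, ?_⟩, fun h => ?_⟩
  · rintro ⟨rfl, haut, c, hc, a, ha, rfl, rfl⟩
    rw [weightedComp_smul hc, weightedComp_smul (by simpa using hc)]
    exact (haut.isUnitaryOperator_weightedComp ha).mulAdjointEqOne hc
  · obtain ⟨rfl, haut, c, hc, a, ha, rfl, rfl⟩ := hforward h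
    exact ⟨a, ha, haut.isUnitaryOperator_weightedComp ha, ⟨c, weightedComp_smul hc _ _⟩,
      ⟨_, weightedComp_smul (by simpa using hc) _ _⟩⟩
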